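/- Let $R$ be a commutative ring and let $a=(a_i)_{i\in\mathbb Z}$ be a doubly infinite sequence of elements of $R$. For $k\in\mathbb Z$ let $\tau^k a$ be the sequence with $(\tau^k a)_i=a_{i+k}$. Put $(t\mid a)^r=(t+a_1)(t+a_2)\cdots(t+a_r)$ for $r\ge 0$. For indeterminates $x=(x_1,\dots,x_n)$ (with $n\ge 0$) and $\alpha\in\mathbb N^n$ put $A_\alpha(x\mid a)=\det\big((x_i\mid a)^{\alpha_j}\big)_{1\le i,j\le n}$, let $\delta=(n-1,n-2,\dots,1,0)$, and for a partition $\lambda$ of length at most $n$ let $s_\lambda(x\mid a)=A_{\lambda+\delta}(x\mid a)/A_\delta(x\mid a)\in R[x_1,\dots,x_n]$. Let $h_r(x\mid a)=s_{(r)}(x\mid a)$ for $r\ge 0$, except that $h_r(x\mid a)=0$ if $n=0$ and $r>0$; let $h_r(x\mid a)=0$ for $r<0$. For arbitrary partitions $\lambda,\mu$ put $$s_{\lambda/\mu}(x\mid a)=\det\Big(h_{\lambda_i-\mu_j-i+j}\big(x\mid \tau^{\mu_j-j+1}a\big)\Big)_{1\le i,j\le q},\qquad q=\max(\ell(\lambda),\ell(\mu)),$$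 where $\ell$ denotes the length (number of nonzero parts) of a partition. Let $x=(x_1,\dots,x_n)$ and $y=(y_1,\dots,y_m)$ be two families of independent indeterminates, $n,m\ge 0$, and let $(x,y)=(x_1,\dots,x_n,y_1,\dots,y_m)$. Then for all partitions $\lambda,\mu$ the following identity holds in $R[x_1,\dots,x_n,y_1,\dots,y_m]$: $$s_{\lambda/\mu}(x,y\mid a)=\sum_{\nu}s_{\nu/\mu}(x\mid a)\,s_{\lambda/\nu}(y\mid \tau^n a),$$ where the sum ranges over all partitions $\nu$ and only finitely many of its terms are nonzero. -/

import Mathlib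

namespace SixthVariation

variable {R : Type*} [CommRing R]

/-- The shift `τ^k` on doubly infinite sequences: `(τ^k a)_i = a_{i+k}`. -/
def shift (k : ℤ) (a : ℤ → R) : ℤ → R := fun i => a (i + k)

/-- The generalized power `(t | a)^r = (t + a_1)(t + a_2) ⋯ (t + a_r)`, for `t` in an
`R`-algebra. -/
def genPow {S : Type*} [CommRing S] [Algebra R S] (a : ℤ → R) (t : S) (r : ℕ) : S :=
  ∏ k ∈ Finset.range r, (t + algebraMap R S (a ((k : ℤ) + 1)))

/-- `A_α(x | a) = det ((x_i | a)^{α_j})` for `α ∈ ℕ^n` and indeterminates `x_1, …, x_n`. -/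
noncomputable def altDet (n : ℕ) (a : ℤ → R) (α : Fin n → ℕ) : MvPolynomial (Fin n) R :=
  Matrix.det (Matrix.of fun i j : Fin n => genPow a (MvPolynomial.X i) (α j))

/-- `δ = (n - 1, n - 2, …, 1, 0)`. -/
def stair (n : ℕ) : Fin n → ℕ := fun j => n - 1 - (j : ℕ)

/-- `A_δ(x | a)` is the Vandermonde determinant up to sign. -/
theorem altDet_stair (n : ℕ) (a : ℤ → R) :
    ∃ ε : ℤˣ, altDet n a (stair n) = ((ε : ℤ) : MvPolynomial (Fin n) R) *
      (Matrix.vandermonde (MvPolynomial.X : Fin n → MvPolynomial (Fin n) R)).det := by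
  rcases subsingleton_or_nontrivial R with hR | hR
  · exact ⟨1, Subsingleton.elim _ _⟩
  refine ⟨Equiv.Perm.sign (Fin.revPerm : Equiv.Perm (Fin n)), ?_⟩
  let p : Fin n → Polynomial (MvPolynomial (Fin n) R) := fun j =>
    ∏ k ∈ Finset.range (j : ℕ), (Polynomial.X + Polynomial.C (MvPolynomial.C (a ((k : ℤ) + 1))))
  have h1 : ∀ j, (p j).natDegree = (j : ℕ) := fun j => by
    simp only [p]
    rw [Polynomial.natDegree_prod_of_monic _ _ fun k _ => Polynomial.monic_X_add_C _]
    simp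
  have h2 : ∀ j, (p j).Monic := fun j =>
    Polynomial.monic_prod_of_monic _ _ fun k _ => Polynomial.monic_X_add_C _
  rw [Matrix.det_eval_matrixOfPolynomials_eq_det_vandermonde _ p h1 h2,
    ← Matrix.det_permute']
  unfold altDet
  congr 1
  ext1 i j
  simp only [Matrix.of_apply, Matrix.submatrix_apply, p, Polynomial.eval_prod, genPow, stair,
    id, Fin.revPerm_apply, Fin.val_rev]
  rw [show n - 1 - (j : ℕ) = n - ((j : ℕ) + 1) by omega]
  simp [MvPolynomial.algebraMap_eq]

/-- `A_δ(x | a)` is not a zero divisor, so a quotient by it is unique when it exists. -/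
theorem altDet_stair_isRegular (n : ℕ) (a : ℤ → R) : IsRegular (altDet n a (stair n)) := by
  rcases subsingleton_or_nontrivial R with hR | hR
  · exact ⟨fun _ _ _ => Subsingleton.elim _ _, fun _ _ _ => Subsingleton.elim _ _⟩
  obtain ⟨ε, h⟩ := altDet_stair n a
  rw [h, Matrix.det_vandermonde]
  refine (((ε.isUnit.map (Int.castRingHom (MvPolynomial (Fin n) R)))).isRegular).mul
    (IsRegular.prod fun i _ => IsRegular.prod fun j hj => ?_)
  have hij : i < j := Finset.mem_Ioi.mp hj
  have key : ∀ q : MvPolynomial (Fin n) R,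
      (MvPolynomial.X j - MvPolynomial.X i) * q = 0 → q = 0 := fun q hq => by
    by_contra hq0
    have hlt : (MonomialOrder.lex (σ := Fin n)).toSyn
        ((MonomialOrder.lex (σ := Fin n)).degree (MvPolynomial.X j : MvPolynomial (Fin n) R)) <
        (MonomialOrder.lex (σ := Fin n)).toSyn
        ((MonomialOrder.lex (σ := Fin n)).degree (MvPolynomial.X i : MvPolynomial (Fin n) R)) := by
      rw [MonomialOrder.degree_X, MonomialOrder.degree_X]
      exact MonomialOrder.lex_lt_iff.mpr (Finsupp.Lex.single_lt_iff.mpr hij)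
    have hlc : (MonomialOrder.lex (σ := Fin n)).leadingCoeff
        (MvPolynomial.X i - MvPolynomial.X j : MvPolynomial (Fin n) R) = 1 := by
      rw [MonomialOrder.leadingCoeff_sub_of_lt hlt, MonomialOrder.leadingCoeff_X]
    have hq' : (MvPolynomial.X i - MvPolynomial.X j) * q = 0 := by
      rw [← neg_sub, neg_mul, hq, neg_zero]
    have h3 := (MonomialOrder.lex (σ := Fin n)).leadingCoeff_mul_of_left_mem_nonZeroDivisors
      (f := MvPolynomial.X i - MvPolynomial.X j) (g := q) (by rw [hlc]; exact one_mem _)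
    rw [hq', hlc, one_mul, MonomialOrder.leadingCoeff_zero] at h3
    exact hq0 (MonomialOrder.leadingCoeff_eq_zero_iff.mp h3.symm)
  exact isRegular_iff_mem_nonZeroDivisors.mpr (mem_nonZeroDivisors_iff_left.mpr key)

/-- `A_δ(x | a)` divides `A_α(x | a)` in `R[x_1, …, x_n]`. -/
theorem altDet_stair_dvd (n : ℕ) (a : ℤ → R) (α : Fin n → ℕ) :
    altDet n a (stair n) ∣ altDet n a α := by
  rcases subsingleton_or_nontrivial R with hR | hR
  · exact ⟨0, Subsingleton.elim _ _⟩
  obtain ⟨ε, h⟩ := altDet_stair n a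
  have hu : IsUnit (((ε : ℤ) : MvPolynomial (Fin n) R)) :=
    ε.isUnit.map (Int.castRingHom (MvPolynomial (Fin n) R))
  rw [h, hu.mul_left_dvd]
  let Q : Polynomial (MvPolynomial (Fin n) R) :=
    ∏ i, (Polynomial.X - Polynomial.C (MvPolynomial.X i))
  have hQ : Q.Monic := Polynomial.monic_prod_of_monic _ _ fun k _ => Polynomial.monic_X_sub_C _
  have hQd : Q.natDegree = n := by
    simp only [Q]
    rw [Polynomial.natDegree_prod_of_monic _ _ fun k _ => Polynomial.monic_X_sub_C _]
    simp
  let P : Fin n → Polynomial (MvPolynomial (Fin n) R) := fun j =>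
    (∏ k ∈ Finset.range (α j),
      (Polynomial.X + Polynomial.C (MvPolynomial.C (a ((k : ℤ) + 1))))) %ₘ Q
  have hP : ∀ j, (P j).natDegree < n := fun j => by
    have := Polynomial.natDegree_modByMonic_lt
      (∏ k ∈ Finset.range (α j),
        (Polynomial.X + Polynomial.C (MvPolynomial.C (σ := Fin n) (a ((k : ℤ) + 1))))) hQ
      (fun h0 => by
        have hn : n = 0 := by rw [← hQd, h0, Polynomial.natDegree_one]
        subst hn
        exact j.elim0)
    rwa [hQd] at this
  refine ⟨(Matrix.of fun i j : Fin n => (P j).coeff i).det, ?_⟩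
  rw [← Matrix.det_mul]
  unfold altDet
  congr 1
  ext1 i j
  have hev : (P j).eval (MvPolynomial.X i) = genPow a (MvPolynomial.X i) (α j) := by
    have hroot : Q.eval (MvPolynomial.X i) = 0 := by
      simp only [Q, Polynomial.eval_prod]
      exact Finset.prod_eq_zero (Finset.mem_univ i) (by simp)
    have := congrArg (Polynomial.eval (MvPolynomial.X i : MvPolynomial (Fin n) R))
      (Polynomial.modByMonic_add_div (∏ k ∈ Finset.range (α j),
        (Polynomial.X + Polynomial.C (MvPolynomial.C (σ := Fin n) (a ((k : ℤ) + 1))))) Q)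
    rw [Polynomial.eval_add, Polynomial.eval_mul, hroot, zero_mul, add_zero] at this
    simp only [P]
    rw [this]
    simp [genPow, Polynomial.eval_prod, MvPolynomial.algebraMap_eq]
  rw [Matrix.of_apply, ← hev, Polynomial.eval_eq_sum_range' (hP j), Matrix.mul_apply,
    Finset.sum_range]
  refine Finset.sum_congr rfl fun k _ => ?_
  simp [Matrix.vandermonde_apply, mul_comm]

/-- The polynomial `s_λ(x | a) = A_{λ+δ}(x | a) / A_δ(x | a)` in `R[x_1, …, x_n]`, for a
partition `λ = (λ_1, …, λ_n)` of length at most `n`; the quotient exists and is unique by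
`altDet_stair_dvd` and `altDet_stair_isRegular`. -/
noncomputable def schur (n : ℕ) (a : ℤ → R) (l : Fin n → ℕ) : MvPolynomial (Fin n) R :=
  Classical.choose (altDet_stair_dvd n a (l + stair n))

theorem altDet_stair_mul_schur (n : ℕ) (a : ℤ → R) (l : Fin n → ℕ) :
    altDet n a (stair n) * schur n a l = altDet n a (l + stair n) :=
  (Classical.choose_spec (altDet_stair_dvd n a (l + stair n))).symm

/-- `h_r(x | a)` for `r ∈ ℤ` and `n` indeterminates: it is `s_{(r)}(x | a)` for `r ≥ 0`, with
`h_r = 0` for `r < 0`, and also for `r > 0` when `n = 0`. -/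
noncomputable def hPoly (n : ℕ) (a : ℤ → R) (r : ℤ) : MvPolynomial (Fin n) R :=
  if r < 0 ∨ (n = 0 ∧ 0 < r) then 0
  else schur n a (fun i => if (i : ℕ) = 0 then r.toNat else 0)

/-- `s_{λ/μ}(x | a) = det (h_{λ_i - μ_j - i + j}(x | τ^{μ_j - j + 1} a))_{1 ≤ i, j ≤ m}` for
arbitrary partitions `λ`, `μ`, where `m` is the larger of their lengths. Row and column indices
start at `0` in the code, as do those of `YoungDiagram.rowLen`; `colLen 0` is the length. -/
noncomputable def skewSchur (n : ℕ) (a : ℤ → R) (lam mu : YoungDiagram) :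
    MvPolynomial (Fin n) R :=
  Matrix.det (Matrix.of fun i j : Fin (max (lam.colLen 0) (mu.colLen 0)) =>
    hPoly n (shift ((mu.rowLen j : ℤ) - (j : ℤ)) a)
      ((lam.rowLen i : ℤ) - (mu.rowLen j : ℤ) - (i : ℤ) + (j : ℤ)))

end SixthVariation

namespace SixthVariation

/-! ### The matrix of the `h_r` as a product over the variables. -/

section Kernel

/-! For fixed variables, the elements `h_{q-p}(x | τ^p a)` form a unitriangular matrix indexed by
integers `p ≤ q`, and this matrix factors into one-variable matrices, the sequence being shifted
once per variable. A skew polynomial is a minor of it, with rows `μ_j - j` and columns `λ_i - i`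
(indices from 0). The matrix of `(x, y)` is therefore the matrix of `x` at `a` times that of `y` at
`τ^n a` (`kernel_append`), and the identity is Cauchy–Binet, the intermediate index sets being the
sequences `ν_i - i`.

Two points carry the work. `hPoly_eq_kernel` identifies the determinantal `h_r` with the product
matrix, by iterating divided differences of generalized powers. `shapeMinor_mul` turns the
Cauchy–Binet sum into a sum over diagrams: triangularity forces `ν ≤ λ`, and unitriangularity
(`shapeMinor_eq_of_le`) allows one minor size for all terms. -/

theorem shift_shift (k l : ℤ) {R : Type*} (a : ℤ → R) : shift k (shift l a) = shift (k + l) a := by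
  funext i
  simp [shift, add_assoc]

theorem shift_zero {R : Type*} (a : ℤ → R) : shift 0 a = a := by
  funext i
  simp [shift]

variable {R S : Type*} [CommRing R] [CommRing S] [Algebra R S]

@[simp] theorem genPow_zero (a : ℤ → R) (t : S) : genPow a t 0 = 1 := by simp [genPow]

theorem genPow_succ' (a : ℤ → R) (t : S) (r : ℕ) :
    genPow a t (r + 1) = (t + algebraMap R S (a 1)) * genPow (shift 1 a) t r := by
  simp only [genPow, Finset.prod_range_succ', shift]
  rw [mul_comm]
  simp

theorem map_genPow {T : Type*} [CommRing T] [Algebra R T] (φ : S →ₐ[R] T) (a : ℤ → R) (t : S)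
    (r : ℕ) : φ (genPow a t r) = genPow a (φ t) r := by
  simp [genPow]

/-- Divided difference of a generalized power. -/
theorem genPow_sub_genPow (a : ℤ → R) (x t : S) (N : ℕ) :
    genPow a t N - genPow a x N =
      (t - x) * ∑ j ∈ Finset.range N,
        genPow a x j * genPow (shift ((j : ℤ) + 1) a) t (N - 1 - j) := by
  induction N generalizing a with
  | zero => simp
  | succ N ih =>
    rw [Finset.sum_range_succ', genPow_succ' a t, genPow_succ' a x]
    have h : ∑ k ∈ Finset.range N, genPow a x (k + 1) *
        genPow (shift (((k + 1 : ℕ) : ℤ) + 1) a) t (N + 1 - 1 - (k + 1)) =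
        (x + algebraMap R S (a 1)) * ∑ j ∈ Finset.range N, genPow (shift 1 a) x j *
          genPow (shift ((j : ℤ) + 1) (shift 1 a)) t (N - 1 - j) := by
      rw [Finset.mul_sum]
      refine Finset.sum_congr rfl fun k _ => ?_
      rw [genPow_succ', shift_shift, show N + 1 - 1 - (k + 1) = N - 1 - k by omega]
      push_cast
      ring
    rw [h, mul_add, ← mul_assoc, mul_comm (t - x), mul_assoc, ← ih]
    simp
    ring

/-- The matrix `((t | τ^p a)^{q - p})_{p ≤ q}` attached to one variable `t`. -/
noncomputable def kernelOne (a : ℤ → R) (t : S) : IncidenceAlgebra S ℤ :=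
  ⟨fun p q => if p ≤ q then genPow (shift p a) t (q - p).toNat else 0, fun _ _ h => if_neg h⟩

theorem kernelOne_apply (a : ℤ → R) (t : S) (p q : ℤ) :
    kernelOne a t p q = if p ≤ q then genPow (shift p a) t (q - p).toNat else 0 := rfl

/-- The matrix of complete symmetric functions `h_{q - p}(x | τ^p a)`, as the ordered product of
the matrices of the single variables. -/
noncomputable def kernel : (n : ℕ) → (ℤ → R) → (Fin n → S) → IncidenceAlgebra S ℤ
  | 0, _, _ => 1
  | n + 1, a, x => kernelOne a (x 0) * kernel n (shift 1 a) (Fin.tail x)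

theorem kernel_succ (n : ℕ) (a : ℤ → R) (x : Fin (n + 1) → S) :
    kernel (n + 1) a x = kernelOne a (x 0) * kernel n (shift 1 a) (Fin.tail x) := rfl

theorem kernel_self (n : ℕ) (a : ℤ → R) (x : Fin n → S) (p : ℤ) : kernel n a x p p = 1 := by
  induction n generalizing a with
  | zero => simp [kernel]
  | succ n ih => simp [kernel, ih, kernelOne_apply]

/-- The factors for `y` come after `n` shifts, which is the source of `τ^n a`. -/
theorem kernel_append (n m : ℕ) (a : ℤ → R) (x : Fin n → S) (y : Fin m → S)
    (z : Fin (n + m) → S) (hx : ∀ i, z (Fin.castAdd m i) = x i)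
    (hy : ∀ i, z (Fin.natAdd n i) = y i) :
    kernel (n + m) a z = kernel n a x * kernel m (shift n a) y := by
  induction n generalizing a with
  | zero =>
    have h : ∀ (k : ℕ) (hk : k = m) (w : Fin k → S), (∀ i, w (Fin.cast hk.symm i) = y i) →
        kernel k a w = kernel m a y := by
      rintro k rfl w hw
      congr 1
      exact funext hw
    have := h (0 + m) (zero_add m) z fun i => by
      rw [← hy i]
      congr 1
      ext
      simp
    rw [this]
    simp [kernel, shift_zero]
  | succ n ih =>
    have h : ∀ (k : ℕ) (hk : k = n + m + 1) (w : Fin k → S),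
        kernel k a w = kernel (n + m + 1) a fun i => w (Fin.cast hk.symm i) := by
      rintro k rfl w
      rfl
    rw [h (n + 1 + m) (by omega) z, kernel, kernel, mul_assoc]
    congr 1
    · rw [← hx 0]
      congr 1
    · rw [ih (shift 1 a) (Fin.tail x)]
      · rw [shift_shift]
        push_cast
        rfl
      · intro i
        simp only [Fin.tail]
        rw [← hx]
        congr 1
      · intro i
        simp only [Fin.tail]
        rw [← hy]
        congr 1
        ext
        simp
        omega

theorem map_kernel {T : Type*} [CommRing T] [Algebra R T] (φ : S →ₐ[R] T) (n : ℕ) (a : ℤ → R)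
    (x : Fin n → S) (p q : ℤ) : φ (kernel n a x p q) = kernel n a (fun i => φ (x i)) p q := by
  induction n generalizing a p q with
  | zero => simp [kernel, apply_ite φ]
  | succ n ih =>
    simp only [kernel, IncidenceAlgebra.mul_apply, map_sum, map_mul, ih, kernelOne_apply,
      apply_ite φ, map_zero, map_genPow]
    rfl

open Polynomial in
/-- The generalized power `(X | a)^r` as a polynomial. -/
noncomputable def genPoly (S : Type*) [CommRing S] [Algebra R S] (a : ℤ → R) (r : ℕ) : S[X] :=
  ∏ k ∈ Finset.range r, (X + C (algebraMap R S (a ((k : ℤ) + 1))))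

theorem eval_genPoly (a : ℤ → R) (t : S) (r : ℕ) : (genPoly S a r).eval t = genPow a t r := by
  simp [genPoly, genPow, Polynomial.eval_prod]

theorem degree_genPoly_le (a : ℤ → R) (r : ℕ) : (genPoly S a r).degree ≤ r := by
  rcases subsingleton_or_nontrivial S with h | h
  · rw [Subsingleton.elim (genPoly S a r) 0]
    simp
  · rw [genPoly, Polynomial.degree_prod_of_monic _ _ fun _ _ => Polynomial.monic_X_add_C _]
    simp

theorem coeff_genPoly_self (a : ℤ → R) (r : ℕ) : (genPoly S a r).coeff r = 1 := by
  rcases subsingleton_or_nontrivial S with h | h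
  · exact Subsingleton.elim _ _
  · have h1 : (genPoly S a r).Monic :=
      Polynomial.monic_prod_of_monic _ _ fun _ _ => Polynomial.monic_X_add_C _
    have h2 : (genPoly S a r).natDegree = r := by
      rw [genPoly, Polynomial.natDegree_prod_of_monic _ _ fun _ _ => Polynomial.monic_X_add_C _]
      simp
    rw [Polynomial.Monic, Polynomial.leadingCoeff, h2] at h1
    exact h1

/-- Polynomials of degree less than `n` are combinations of the generalized powers of degree less
than `n`. -/
theorem exists_eq_sum_genPoly (a : ℤ → R) (n : ℕ) (h : Polynomial S) (hh : h.degree < n) :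
    ∃ b : ℕ → S, h = ∑ j ∈ Finset.range n, Polynomial.C (b j) * genPoly S a j := by
  induction n generalizing h with
  | zero => exact ⟨0, by simpa using hh⟩
  | succ n ih =>
    have h1 : (h - Polynomial.C (h.coeff n) * genPoly S a n).degree < n := by
      rw [Polynomial.degree_lt_iff_coeff_zero] at hh ⊢
      intro k hk
      rw [Polynomial.coeff_sub, Polynomial.coeff_C_mul]
      rcases hk.eq_or_lt with rfl | hk
      · rw [coeff_genPoly_self, mul_one, sub_self]
      · rw [hh k hk, Polynomial.coeff_eq_zero_of_degree_lt
          ((degree_genPoly_le a n).trans_lt (by exact_mod_cast hk))]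
        simp
    obtain ⟨b, hb⟩ := ih _ h1
    refine ⟨fun j => if j = n then h.coeff n else b j, ?_⟩
    simp only [Finset.sum_range_succ, if_true]
    rw [← sub_eq_iff_eq_add, hb]
    refine Finset.sum_congr rfl fun j hj => ?_
    rw [if_neg (Finset.mem_range.mp hj).ne]

/-- On the points `x_0, …, x_n`, the generalized power `(t | τ^p a)^N` agrees with a polynomial of
degree at most `n` whose leading coefficient is the entry `(p, p + N - n)` of the kernel. -/
theorem exists_genPow_eq (n : ℕ) (a : ℤ → R) (x : Fin (n + 1) → S) (p : ℤ) (N : ℕ) :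
    ∃ g : Polynomial S, g.degree < n ∧ ∀ i, genPow (shift p a) (x i) N =
      kernel (n + 1) a x p (p + N - n) * x i ^ n + g.eval (x i) := by
  induction n generalizing a p N with
  | zero =>
    refine ⟨0, by simp, fun i => ?_⟩
    rw [Fin.fin_one_eq_zero i]
    simp [kernel, kernelOne_apply]
  | succ n ih =>
    choose g hg hgx using fun j : ℕ =>
      ih (shift 1 a) (Fin.tail x) (p + j) (N - 1 - j)
    -- Insert the inductive expressions into the divided difference at `x 0`. With `c` the new
    -- kernel entry, `c (t - x 0) t^n` contributes `c t^(n+1)`; the witness collects everything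
    -- else.
    refine ⟨Polynomial.C (genPow (shift p a) (x 0) N) +
      (Polynomial.X - Polynomial.C (x 0)) * (∑ j ∈ Finset.range N,
        Polynomial.C (genPow (shift p a) (x 0) j) * g j) - Polynomial.C
          (x 0 * kernel (n + 2) a x p (p + N - (n + 1 : ℕ))) * Polynomial.X ^ n, ?_, fun i => ?_⟩
    · have hsum : (∑ j ∈ Finset.range N,
          Polynomial.C (genPow (shift p a) (x 0) j) * g j).degree < n := by
        rw [← Polynomial.mem_degreeLT]
        refine Submodule.sum_mem _ fun j _ => ?_
        rw [← Polynomial.smul_eq_C_mul]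
        exact Submodule.smul_mem _ _ (Polynomial.mem_degreeLT.mpr (hg j))
      rw [Polynomial.degree_lt_iff_coeff_zero] at hsum ⊢
      intro k hk
      obtain ⟨k, rfl⟩ : ∃ l, k = l + 1 := ⟨k - 1, by omega⟩
      rw [Polynomial.coeff_sub, Polynomial.coeff_add, Polynomial.coeff_C_succ,
        Polynomial.coeff_X_sub_C_mul, hsum k (by omega), hsum (k + 1) (by omega),
        Polynomial.coeff_C_mul_X_pow, if_neg (by omega)]
      simp
    -- This is the matrix product with `r = p + j`; the values of `j` beyond the interval give
    -- entries below the diagonal, hence zero.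
    have hK : ∑ j ∈ Finset.range N, genPow (shift p a) (x 0) j *
        kernel (n + 1) (shift 1 a) (Fin.tail x) (p + j) (p + j + (N - 1 - j : ℕ) - n) =
        kernel (n + 2) a x p (p + N - (n + 1 : ℕ)) := by
      rw [kernel_succ (n + 1), IncidenceAlgebra.mul_apply]
      symm
      refine Finset.sum_of_injOn (fun r => (r - p).toNat) ?_ ?_ ?_ ?_
      · intro r hr r' hr' h
        simp only [Finset.coe_Icc, Set.mem_Icc] at hr hr' h
        omega
      · intro r hr
        simp only [Finset.coe_Icc, Set.mem_Icc, Finset.coe_range, Set.mem_Iio] at hr ⊢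
        omega
      · intro j hj hj'
        rw [IncidenceAlgebra.apply_eq_zero_of_not_le, mul_zero]
        intro hle
        refine hj' ⟨p + j, ?_, by simp⟩
        have := Finset.mem_range.mp hj
        simp only [Finset.coe_Icc, Set.mem_Icc]
        omega
      · intro r hr
        rw [Finset.mem_Icc] at hr
        rw [kernelOne_apply, if_pos hr.1]
        have h1 : p + ((r - p).toNat : ℤ) = r := by omega
        have h2 : r + ((N - 1 - (r - p).toNat : ℕ) : ℤ) - n = p + N - (n + 1 : ℕ) := by omega
        rw [h1, h2]
    have hx := genPow_sub_genPow (shift p a) (x 0) (x i) N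
    rw [sub_eq_iff_eq_add] at hx
    rw [hx]
    refine Fin.cases ?_ (fun i => ?_) i
    · simp
      ring
    · have : ∑ j ∈ Finset.range N, genPow (shift p a) (x 0) j *
          genPow (shift ((j : ℤ) + 1) (shift p a)) (x i.succ) (N - 1 - j) =
          kernel (n + 2) a x p (p + N - (n + 1 : ℕ)) * x i.succ ^ n +
          ∑ j ∈ Finset.range N, genPow (shift p a) (x 0) j * (g j).eval (x i.succ) := by
        rw [← hK, Finset.sum_mul, ← Finset.sum_add_distrib]
        refine Finset.sum_congr rfl fun j _ => ?_
        have := hgx j i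
        simp only [Fin.tail, shift_shift] at this ⊢
        rw [show (j : ℤ) + 1 + p = p + j + 1 by ring, this]
        ring
      rw [this]
      simp [Polynomial.eval_finsetSum]
      ring

end Kernel

/-- On the points `x_i`, the generalized power in the first column of the numerator equals the
kernel entry times `(t | τ^p a)^n`, plus lower generalized powers. The latter are the other columns
of `A_δ`, so column operations extract the entry as the quotient. -/
theorem hPoly_eq_kernel {R : Type*} [CommRing R] (n : ℕ) (a : ℤ → R) (p q : ℤ) :
    hPoly n (shift p a) (q - p) =
      kernel n a (MvPolynomial.X : Fin n → MvPolynomial (Fin n) R) p q := by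
  rcases n with _ | n
  -- With no variables the matrix is the identity; the convention for `h_r` with `n = 0` supplies
  -- its zeros above the diagonal.
  · rw [hPoly]
    rw [kernel, IncidenceAlgebra.one_apply]
    by_cases hpq : p = q
    · subst hpq
      rw [if_neg (by simp), if_pos rfl]
      have h := altDet_stair_mul_schur 0 (shift p a)
        fun i => if (i : ℕ) = 0 then (p - p).toNat else 0
      simpa [altDet] using h
    · have h : q - p < 0 ∨ 0 < q - p := by omega
      rw [if_pos (h.imp_right fun h => ⟨rfl, h⟩), if_neg hpq]
  rw [hPoly]
  by_cases h1 : q < p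
  · rw [if_pos (Or.inl (by omega : q - p < 0)),
      IncidenceAlgebra.apply_eq_zero_of_not_le (not_le.mpr h1)]
  rw [if_neg (by omega : ¬(q - p < 0 ∨ n + 1 = 0 ∧ 0 < q - p))]
  refine (altDet_stair_isRegular (n + 1) (shift p a)).left ?_
  simp only
  rw [altDet_stair_mul_schur]
  set x : Fin (n + 1) → MvPolynomial (Fin (n + 1)) R := MvPolynomial.X with hx
  obtain ⟨g, hg, hgx⟩ := exists_genPow_eq n a x p ((q - p).toNat + n)
  -- For exponent `n` the leading coefficient is a diagonal entry, namely 1, so `x_i ^ n` can be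
  -- traded for the generalized power.
  obtain ⟨g', hg', hgx'⟩ := exists_genPow_eq n a x p n
  set c := kernel (n + 1) a x p q
  obtain ⟨b, hb⟩ := exists_eq_sum_genPoly (shift p a) n (g - Polynomial.C c * g') (by
    rw [← Polynomial.mem_degreeLT] at hg hg' ⊢
    rw [← Polynomial.smul_eq_C_mul]
    exact Submodule.sub_mem _ hg (Submodule.smul_mem _ _ hg'))
  have key : ∀ i, genPow (shift p a) (x i) ((q - p).toNat + n) =
      c * genPow (shift p a) (x i) n +
        ∑ j ∈ Finset.range n, b j * genPow (shift p a) (x i) j := by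
    intro i
    have h := congrArg (Polynomial.eval (x i)) hb
    simp only [Polynomial.eval_sub, Polynomial.eval_mul, Polynomial.eval_C,
      Polynomial.eval_finsetSum, eval_genPoly] at h
    rw [← h, hgx i, hgx' i]
    rw [show p + ((((q - p).toNat + n : ℕ)) : ℤ) - n = q by omega, add_sub_cancel_right,
      kernel_self]
    ring
  -- Column `j + 1` of `A_δ` has exponent `n - 1 - j`, hence the reversed index of `b`.
  have hdet := Matrix.det_updateCol_sum
    (Matrix.of fun i j : Fin (n + 1) => genPow (shift p a) (x i) (stair (n + 1) j)) 0
    (Fin.cons c fun j => b (n - 1 - j))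
  rw [Fin.cons_zero, smul_eq_mul, mul_comm] at hdet
  rw [altDet, altDet]
  refine Eq.trans ?_ hdet
  congr 1
  ext1 i j
  refine Fin.cases ?_ (fun j => ?_) j
  · rw [Matrix.updateCol_self, Fin.sum_univ_succ]
    simp only [Matrix.of_apply, Pi.add_apply, stair, Fin.cons_zero, Fin.cons_succ, smul_eq_mul]
    simp only [Fin.val_zero, if_true, Nat.sub_zero, Nat.add_sub_cancel]
    rw [key i]
    congr 1
    rw [← Finset.sum_range_reflect, Finset.sum_range]
    refine Finset.sum_congr rfl fun k _ => ?_
    rw [Fin.val_succ, show n - ((k : ℕ) + 1) = n - 1 - k by omega]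
  · rw [Matrix.updateCol_ne (Fin.succ_ne_zero j)]
    simp [stair, hx]

/-! ### Cauchy–Binet and minors of triangular matrices. -/

section Det

variable {S : Type*} [CommRing S]

/-- The Cauchy–Binet formula, with the sum over strictly decreasing families of indices. -/
theorem det_sum_mul_eq_sum_strictAnti {α : Type*} [LinearOrder α] {N : ℕ} (s : Finset α)
    (A : Fin N → α → S) (B : α → Fin N → S) :
    (Matrix.of fun i j => ∑ r ∈ s, A i r * B r j).det =
      ∑ f ∈ (Fintype.piFinset fun _ : Fin N => s) with StrictAnti f,
        (Matrix.of fun i j => A i (f j)).det * (Matrix.of fun i j => B (f i) j).det := by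
  have h1 : (Matrix.of fun i j => ∑ r ∈ s, A i r * B r j).det =
      ∑ f ∈ Fintype.piFinset fun _ : Fin N => s,
        (∏ i, A i (f i)) * (Matrix.of fun i j => B (f i) j).det := by
    have := (Matrix.detRowAlternating (n := Fin N) (R := S)).toMultilinearMap.map_sum_finset
      (fun i r j => A i r * B r j) fun _ => s
    simp only [← Matrix.det_mul_column, Matrix.of_apply]
    rw [show (Matrix.of fun i j => ∑ r ∈ s, A i r * B r j) =
      fun i => ∑ r ∈ s, fun j => A i r * B r j by ext; simp]
    exact this
  have h2 : ∑ f ∈ Fintype.piFinset fun _ : Fin N => s,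
        (∏ i, A i (f i)) * (Matrix.of fun i j => B (f i) j).det =
      ∑ f ∈ (Fintype.piFinset fun _ : Fin N => s) with Function.Injective f,
        (∏ i, A i (f i)) * (Matrix.of fun i j => B (f i) j).det := by
    rw [Finset.sum_filter_of_ne]
    intro f _ hne
    by_contra hf
    rw [Function.not_injective_iff] at hf
    obtain ⟨i, j, hij, hne'⟩ := hf
    exact hne (by rw [Matrix.det_zero_of_row_eq hne' (by ext; simp [hij]), mul_zero])
  rw [h1, h2]
  -- Expand the first determinant; each sign is absorbed by permuting the rows of the second.
  have h3 : ∀ f : Fin N → α,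
      (Matrix.of fun i j => A i (f j)).det * (Matrix.of fun i j => B (f i) j).det =
      ∑ σ : Equiv.Perm (Fin N), (∏ i, A i (f (σ i))) *
        (Matrix.of fun i j => B (f (σ i)) j).det := by
    intro f
    rw [← Matrix.det_transpose, Matrix.det_apply', Finset.sum_mul]
    refine Finset.sum_congr rfl fun σ _ => ?_
    have := Matrix.det_permute σ (Matrix.of fun i j => B (f i) j)
    rw [show (Matrix.of fun i j => B (f (σ i)) j) =
      (Matrix.of fun i j => B (f i) j).submatrix σ id by ext; simp, this]
    simp
    ring
  simp only [h3]
  rw [Finset.sum_sigma']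
  symm
  -- Every injective family is uniquely a strictly decreasing one composed with a permutation, found
  -- by sorting.
  refine Finset.sum_bij (fun z _ => z.1 ∘ z.2) ?_ ?_ ?_ ?_
  · rintro ⟨f, σ⟩ h
    simp only [Finset.mem_sigma, Finset.mem_filter, Fintype.mem_piFinset, Finset.mem_univ,
      and_true] at h ⊢
    exact ⟨fun i => h.1 _, h.2.injective.comp σ.injective⟩
  · rintro ⟨f, σ⟩ h ⟨g, τ⟩ h' heq
    simp only [Finset.mem_sigma, Finset.mem_filter, Fintype.mem_piFinset, Finset.mem_univ,
      and_true] at h h' heq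
    have hf : (f ∘ σ) ∘ σ.symm = f := by ext; simp
    have hg : (f ∘ σ) ∘ τ.symm = g := by rw [heq]; ext; simp
    have hfg : f = g := by
      rw [← hf, ← hg]
      refine Tuple.unique_antitone ?_ ?_
      · rw [hf]
        exact h.2.antitone
      · rw [hg]
        exact h'.2.antitone
    subst hfg
    have : σ = τ := Equiv.ext fun i => h.2.injective (congrFun heq i)
    rw [this]
  · intro f h
    simp only [Finset.mem_filter, Fintype.mem_piFinset] at h
    let σ := Tuple.sort (OrderDual.toDual ∘ f)
    have hm : Monotone (OrderDual.toDual ∘ f ∘ σ) := Tuple.monotone_sort (OrderDual.toDual ∘ f)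
    have ha : StrictAnti (f ∘ σ) :=
      (show Antitone (f ∘ σ) from fun i j hij => hm hij).strictAnti_of_injective
        (h.2.comp σ.injective)
    refine ⟨⟨f ∘ σ, σ.symm⟩, ?_, ?_⟩
    · simp only [Finset.mem_sigma, Finset.mem_filter, Fintype.mem_piFinset, Finset.mem_univ,
        and_true]
      exact ⟨fun i => h.1 _, ha⟩
    · ext
      simp
  · intros
    rfl

/-- A minor of an upper triangular matrix with decreasing families of row indices `p` and of
column indices `q` vanishes unless `p ≤ q`. -/
theorem le_of_det_ne_zero (K : IncidenceAlgebra S ℤ) {N : ℕ} {p q : Fin N → ℤ} (hp : Antitone p)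
    (hq : Antitone q) (h : (Matrix.of fun i j => K (p i) (q j)).det ≠ 0) : p ≤ q := by
  intro k
  by_contra hk
  push Not at hk
  refine h ?_
  rw [Matrix.det_apply]
  refine Finset.sum_eq_zero fun σ _ => ?_
  -- Pigeonhole: `σ` cannot map the indices `≥ k` injectively into those `> k`. For such `i`, `q i ≤
  -- q k < p k ≤ p (σ i)`, so this factor is below the diagonal.
  have : ∃ i, k ≤ i ∧ σ i ≤ k := by
    by_contra hcon
    push Not at hcon
    have h1 : ((Finset.Ici k).map σ.toEmbedding) ⊆ Finset.Ioi k := by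
      intro j hj
      obtain ⟨i, hi, rfl⟩ := Finset.mem_map.mp hj
      exact Finset.mem_Ioi.mpr (hcon i (Finset.mem_Ici.mp hi))
    have h2 := Finset.card_le_card h1
    rw [Finset.card_map, Fin.card_Ici, Fin.card_Ioi] at h2
    omega
  obtain ⟨i, hi, hσ⟩ := this
  rw [Finset.prod_eq_zero (Finset.mem_univ i), smul_zero]
  refine IncidenceAlgebra.apply_eq_zero_of_not_le ?_ K
  exact not_le.mpr (((hq hi).trans_lt hk).trans_le (hp hσ))

/-- Minors of a unitriangular matrix do not change when both families of indices are extended by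
the same smallest index. -/
theorem det_kernel_succ (K : IncidenceAlgebra S ℤ) (N : ℕ) (p q : Fin (N + 1) → ℤ)
    (hp : StrictAnti p) (hpq : p (Fin.last N) = q (Fin.last N))
    (hK : K (p (Fin.last N)) (p (Fin.last N)) = 1) :
    (Matrix.of fun i j => K (p i) (q j)).det =
      (Matrix.of fun i j : Fin N => K (p i.castSucc) (q j.castSucc)).det := by
  rw [Matrix.det_succ_column _ (Fin.last N), Fin.sum_univ_castSucc, Finset.sum_eq_zero, zero_add]
  · rw [Matrix.of_apply, ← hpq, hK]
    simp only [Fin.val_last, ← two_mul, even_two, Even.mul_right, Even.neg_pow, one_pow, one_mul]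
    congr 1
    ext i j
    simp
  · intro i _
    rw [Matrix.of_apply, IncidenceAlgebra.apply_eq_zero_of_not_le, mul_zero, zero_mul]
    rw [← hpq]
    exact not_le.mpr (hp (Fin.castSucc_lt_last i))

end Det

/-! ### Diagrams as strictly decreasing integer sequences. -/

section Shape

/-- The strictly decreasing sequence `(λ_i - i)_{0 ≤ i < N}`. -/
def shiftedRows (N : ℕ) (lam : YoungDiagram) (i : Fin N) : ℤ := (lam.rowLen i : ℤ) - (i : ℤ)

theorem shiftedRows_strictAnti (N : ℕ) (lam : YoungDiagram) : StrictAnti (shiftedRows N lam) := by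
  intro i j hij
  have h1 := lam.rowLen_anti i j hij.le
  have h2 : (i : ℕ) < j := hij
  simp only [shiftedRows]
  omega

theorem rowLen_eq_zero {lam : YoungDiagram} {i : ℕ} (h : lam.colLen 0 ≤ i) :
    lam.rowLen i = 0 := by
  by_contra hne
  have h1 : (i, 0) ∈ lam := YoungDiagram.mem_iff_lt_rowLen.mpr (Nat.pos_of_ne_zero hne)
  have h2 := YoungDiagram.mem_iff_lt_colLen.mp h1
  omega

theorem le_iff_rowLen_le {lam mu : YoungDiagram} :
    mu ≤ lam ↔ ∀ i, mu.rowLen i ≤ lam.rowLen i := by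
  constructor
  · intro h i
    by_contra! hlt
    exact lt_irrefl _ (YoungDiagram.mem_iff_lt_rowLen.mp
      (h (YoungDiagram.mem_iff_lt_rowLen.mpr hlt)))
  · rintro h ⟨i, j⟩ hc
    exact YoungDiagram.mem_iff_lt_rowLen.mpr
      ((YoungDiagram.mem_iff_lt_rowLen.mp hc).trans_le (h i))

theorem colLen_mono {lam mu : YoungDiagram} (h : mu ≤ lam) (j : ℕ) :
    mu.colLen j ≤ lam.colLen j := by
  by_contra! hlt
  exact lt_irrefl _ (YoungDiagram.mem_iff_lt_colLen.mp
    (h (YoungDiagram.mem_iff_lt_colLen.mpr hlt)))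

theorem shiftedRows_le_iff {N : ℕ} {lam mu : YoungDiagram} (hmu : mu.colLen 0 ≤ N) :
    shiftedRows N mu ≤ shiftedRows N lam ↔ mu ≤ lam := by
  rw [le_iff_rowLen_le]
  constructor
  · intro h i
    by_cases hi : i < N
    · have := h ⟨i, hi⟩
      simp only [shiftedRows] at this
      omega
    · rw [rowLen_eq_zero (by omega)]
      exact Nat.zero_le _
  · intro h i
    have := h i
    simp only [shiftedRows]
    omega

theorem shiftedRows_injOn (N : ℕ) :
    Set.InjOn (shiftedRows N) {nu : YoungDiagram | nu.colLen 0 ≤ N} := by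
  intro mu hmu nu hnu h
  exact le_antisymm ((shiftedRows_le_iff hmu).mp h.le) ((shiftedRows_le_iff hnu).mp h.ge)

/-- Every decreasing sequence below that of `λ` with entries `> -N` comes from a diagram. -/
theorem exists_shiftedRows_eq {N : ℕ} (lam : YoungDiagram) (f : Fin N → ℤ) (hf : StrictAnti f)
    (hle : f ≤ shiftedRows N lam) (hlow : ∀ i, 1 - (N : ℤ) ≤ f i) :
    ∃ nu ≤ lam, shiftedRows N nu = f := by
  -- Strict decrease in `ℤ` makes `f i + i` weakly decreasing; these are the row lengths sought.
  have hgap : ∀ (d : ℕ) (i j : Fin N), (i : ℕ) + d = j → f j + d ≤ f i := by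
    intro d
    induction d with
    | zero =>
      intro i j hij
      rw [show i = j from Fin.ext (by omega)]
      simp
    | succ d ih =>
      intro i j hij
      have hj := j.isLt
      have h1 := ih i ⟨i + d, by omega⟩ rfl
      have h2 : f j < f ⟨i + d, by omega⟩ := hf (by
        rw [Fin.lt_def]
        simp only
        omega)
      push_cast
      omega
  have hnonneg : ∀ i, 0 ≤ f i + (i : ℕ) := by
    intro i
    have hi := i.isLt
    have h1 := hgap (N - 1 - i) i ⟨N - 1, by omega⟩ (by simp only; omega)
    have h2 := hlow ⟨N - 1, by omega⟩
    omega
  -- Cutting the diagram out of `lam` gives finiteness and `nu ≤ lam`; no cell is lost, because `f`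
  -- is bounded by the sequence of `lam`.
  let nu : YoungDiagram :=
    { cells := lam.cells.filter fun c => ∃ h : c.1 < N, (c.2 : ℤ) < f ⟨c.1, h⟩ + c.1
      isLowerSet := by
        rintro ⟨i, j⟩ ⟨i', j'⟩ hc h
        obtain ⟨hi, hj⟩ : i' ≤ i ∧ j' ≤ j := hc
        rw [Finset.mem_coe, Finset.mem_filter] at h ⊢
        obtain ⟨h1, h2, h3⟩ := h
        refine ⟨YoungDiagram.up_left_mem lam hi hj h1, by simp only at h2 ⊢; omega, ?_⟩
        have := hgap (i - i') ⟨i', by simp only at h2; omega⟩ ⟨i, h2⟩ (by simp only; omega)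
        simp only at h3 ⊢
        omega }
  have hmem : ∀ i j, (i, j) ∈ nu ↔ (i, j) ∈ lam ∧ ∃ h : i < N, (j : ℤ) < f ⟨i, h⟩ + i := by
    intro i j
    exact Finset.mem_filter
  refine ⟨nu, fun c hc => ((hmem c.1 c.2).mp hc).1, funext fun i => ?_⟩
  have hrow : nu.rowLen i = (f i + (i : ℕ)).toNat := by
    refine eq_of_forall_lt_iff fun j => ?_
    rw [← YoungDiagram.mem_iff_lt_rowLen, hmem, YoungDiagram.mem_iff_lt_rowLen]
    have h1 := hle i
    simp only [shiftedRows] at h1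
    constructor
    · rintro ⟨-, h, h2⟩
      simp only [Fin.eta] at h2
      omega
    · intro h
      exact ⟨by omega, i.isLt, by simp only [Fin.eta]; omega⟩
  have := hnonneg i
  simp only [shiftedRows, hrow]
  omega

end Shape

/-! ### Minors indexed by pairs of diagrams. -/

section Minor

variable {S : Type*} [CommRing S]

/-- The minor of `K` with rows `μ_i - i` and columns `λ_i - i`, for `0 ≤ i < N`. -/
noncomputable def shapeMinor (K : IncidenceAlgebra S ℤ) (N : ℕ) (lam mu : YoungDiagram) : S :=
  (Matrix.of fun i j => K (shiftedRows N mu i) (shiftedRows N lam j)).det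

/-- Past both lengths, each new index is `-i` for both diagrams, so it adds only a diagonal 1. -/
theorem shapeMinor_eq_of_le (K : IncidenceAlgebra S ℤ) (hK : ∀ p, K p p = 1) {M N : ℕ}
    {lam mu : YoungDiagram} (hM : max (lam.colLen 0) (mu.colLen 0) ≤ M) (hMN : M ≤ N) :
    shapeMinor K N lam mu = shapeMinor K M lam mu := by
  induction N, hMN using Nat.le_induction with
  | base => rfl
  | succ N hN ih =>
    rw [← ih, shapeMinor, det_kernel_succ K N _ _ (shiftedRows_strictAnti _ _) _ (hK _)]
    · rfl
    · simp only [shiftedRows, Fin.val_last]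
      rw [rowLen_eq_zero (by omega), rowLen_eq_zero (by omega)]

theorem le_of_shapeMinor_ne_zero (K : IncidenceAlgebra S ℤ) {N : ℕ} {lam mu : YoungDiagram}
    (hmu : mu.colLen 0 ≤ N) (h : shapeMinor K N lam mu ≠ 0) : mu ≤ lam :=
  (shiftedRows_le_iff hmu).mp (le_of_det_ne_zero K (shiftedRows_strictAnti _ _).antitone
    (shiftedRows_strictAnti _ _).antitone h)

theorem finite_Iic (lam : YoungDiagram) : (Set.Iic lam).Finite := by
  refine Set.Finite.of_finite_image (f := YoungDiagram.cells)
    ((lam.cells.powerset.finite_toSet).subset ?_) fun mu _ nu _ h => YoungDiagram.ext h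
  rintro _ ⟨mu, hmu, rfl⟩
  exact Finset.mem_coe.mpr (Finset.mem_powerset.mpr (YoungDiagram.cells_subset_iff.mpr hmu))

theorem shapeMinor_mul (K L : IncidenceAlgebra S ℤ) {N : ℕ} {lam mu : YoungDiagram}
    (hlam : lam.colLen 0 ≤ N) :
    shapeMinor (K * L) N lam mu =
      ∑ nu ∈ (finite_Iic lam).toFinset, shapeMinor K N nu mu * shapeMinor L N lam nu := by
  set s : Finset ℤ := Finset.Icc (1 - (N : ℤ)) (lam.rowLen 0)
  have hlow : ∀ (nu : YoungDiagram) (i : Fin N), 1 - (N : ℤ) ≤ shiftedRows N nu i := by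
    intro nu i
    have := i.isLt
    simp only [shiftedRows]
    omega
  have hup : ∀ nu ≤ lam, ∀ i : Fin N, shiftedRows N nu i ≤ lam.rowLen 0 := by
    intro nu hnu i
    have h1 := le_iff_rowLen_le.mp hnu i
    have h2 := lam.rowLen_anti 0 i (Nat.zero_le _)
    simp only [shiftedRows]
    omega
  -- Cauchy–Binet needs one summation range for all entries; `s` contains each interval, and
  -- triangularity kills the extra terms.
  have hmul : ∀ i j : Fin N, (K * L) (shiftedRows N mu i) (shiftedRows N lam j) =
      ∑ r ∈ s, K (shiftedRows N mu i) r * L r (shiftedRows N lam j) := by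
    intro i j
    rw [IncidenceAlgebra.mul_apply]
    refine Finset.sum_subset (Finset.Icc_subset_Icc (hlow mu i) (hup lam le_rfl j)) ?_
    intro r _ hr
    rw [Finset.mem_Icc, not_and_or] at hr
    rcases hr with hr | hr
    · rw [IncidenceAlgebra.apply_eq_zero_of_not_le hr, zero_mul]
    · rw [IncidenceAlgebra.apply_eq_zero_of_not_le hr, mul_zero]
  rw [shapeMinor]
  simp only [hmul]
  rw [det_sum_mul_eq_sum_strictAnti s (fun i r => K (shiftedRows N mu i) r)
    fun r j => L r (shiftedRows N lam j)]
  symm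
  refine Finset.sum_of_injOn (shiftedRows N) ?_ ?_ ?_ fun _ _ => rfl
  · refine (shiftedRows_injOn N).mono fun nu hnu => ?_
    rw [Set.Finite.coe_toFinset] at hnu
    exact (colLen_mono hnu 0).trans hlam
  · intro nu hnu
    rw [Set.Finite.coe_toFinset] at hnu
    simp only [Finset.coe_filter, Fintype.mem_piFinset, Set.mem_ofPred_eq]
    exact ⟨fun i => Finset.mem_Icc.mpr ⟨hlow nu i, hup nu hnu i⟩, shiftedRows_strictAnti _ _⟩
  · intro f hf hnot
    rw [Finset.mem_filter, Fintype.mem_piFinset] at hf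
    -- A nonzero minor of `L` bounds `f` by the sequence of `lam`, and then `f` comes from a diagram
    -- `≤ lam`.
    by_contra hne
    have hle := le_of_det_ne_zero L hf.2.antitone (shiftedRows_strictAnti N lam).antitone
      (right_ne_zero_of_mul hne)
    obtain ⟨nu, hnu, rfl⟩ := exists_shiftedRows_eq lam f hf.2 hle
      fun i => (Finset.mem_Icc.mp (hf.1 i)).1
    exact hnot ⟨nu, by simpa using hnu, rfl⟩

end Minor

/-! ### Skew polynomials as minors, and the identity. -/

theorem map_skewSchur {R T : Type*} [CommRing R] [CommRing T] [Algebra R T] {n : ℕ}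
    (φ : MvPolynomial (Fin n) R →ₐ[R] T) (a : ℤ → R) (lam mu : YoungDiagram) {N : ℕ}
    (hN : max (lam.colLen 0) (mu.colLen 0) ≤ N) :
    φ (skewSchur n a lam mu) =
      shapeMinor (kernel n a fun i => φ (MvPolynomial.X i)) N lam mu := by
  -- The transpose is needed because `skewSchur` indexes rows by `lam`, `shapeMinor` by `mu`.
  rw [shapeMinor_eq_of_le _ (kernel_self n a _) le_rfl hN, shapeMinor, skewSchur,
    ← Matrix.det_transpose, AlgHom.map_det]
  congr 1
  ext1 i j
  simp only [AlgHom.mapMatrix_apply, Matrix.map_apply, Matrix.transpose_apply, Matrix.of_apply]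
  rw [← map_kernel, ← hPoly_eq_kernel]
  congr 2
  simp only [shiftedRows]
  ring

theorem skewSchur_eq_zero {R : Type*} [CommRing R] {n : ℕ} (a : ℤ → R) {lam mu : YoungDiagram}
    (h : ¬mu ≤ lam) : skewSchur n a lam mu = 0 := by
  by_contra hne
  have := map_skewSchur (AlgHom.id R (MvPolynomial (Fin n) R)) a lam mu le_rfl
  rw [AlgHom.id_apply] at this
  rw [this] at hne
  exact h (le_of_shapeMinor_ne_zero _ (le_max_right _ _) hne)

end SixthVariation

theorem mainTheorem4 {R : Type*} [CommRing R] (a : ℤ → R) (n m : ℕ) (lam mu : YoungDiagram) :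
    (Function.support fun nu : YoungDiagram =>
      MvPolynomial.rename (Fin.castAdd m) (SixthVariation.skewSchur n a nu mu) *
        MvPolynomial.rename (Fin.natAdd n)
          (SixthVariation.skewSchur m (SixthVariation.shift (n : ℤ) a) lam nu)).Finite ∧
    SixthVariation.skewSchur (n + m) a lam mu =
      ∑ᶠ nu : YoungDiagram,
        MvPolynomial.rename (Fin.castAdd m) (SixthVariation.skewSchur n a nu mu) *
          MvPolynomial.rename (Fin.natAdd n)
            (SixthVariation.skewSchur m (SixthVariation.shift (n : ℤ) a) lam nu) := by
  open SixthVariation in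
  have hsupp : (Function.support fun nu : YoungDiagram =>
      MvPolynomial.rename (Fin.castAdd m) (skewSchur n a nu mu) *
        MvPolynomial.rename (Fin.natAdd n) (skewSchur m (shift (n : ℤ) a) lam nu)) ⊆
      Set.Iic lam := by
    intro nu hnu
    by_contra hle
    refine hnu ?_
    simp only [skewSchur_eq_zero _ hle, map_zero, mul_zero]
  refine ⟨(SixthVariation.finite_Iic lam).subset hsupp, ?_⟩
  rw [finsum_eq_sum_of_support_subset (s := (SixthVariation.finite_Iic lam).toFinset) _
    (by simpa using hsupp)]
  open SixthVariation in
  have h := map_skewSchur (AlgHom.id R (MvPolynomial (Fin (n + m)) R)) a lam mu le_rfl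
  rw [AlgHom.id_apply] at h
  rw [h, SixthVariation.kernel_append n m a _ _ _ (fun _ => rfl) (fun _ => rfl),
    SixthVariation.shapeMinor_mul _ _ (le_max_left _ _)]
  refine Finset.sum_congr rfl fun nu hnu => ?_
  have hnu' : nu ≤ lam := by simpa using hnu
  have hlen := SixthVariation.colLen_mono hnu' 0
  -- The size `max (ℓ(λ)) (ℓ(μ))` suits both factors, since `ν ≤ λ` bounds the length of `ν`.
  rw [SixthVariation.map_skewSchur (N := max (lam.colLen 0) (mu.colLen 0)) _ a nu mu (by omega),
    SixthVariation.map_skewSchur (N := max (lam.colLen 0) (mu.colLen 0)) _ _ lam nu (by omega)]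
  simp
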